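/- For a finite graph $G$ let $\alpha(G)$ be its independence number, and let $\alpha_7(G)$ be the minimum of $\alpha(H)$ over all induced subgraphs $H$ of $G$ on exactly $7$ vertices (so $\alpha_7(G)\ge 3$ means that any $7$ vertices of $G$ contain an independent set of size $3$; this holds vacuously if $G$ has fewer than $7$ vertices). Then any $n$-vertex graph $G$ with $\alpha_7(G)\ge 3$ has $\alpha(G)\ge n^{5/12-o(1)}$. That is, there is a function $\varepsilon:\mathbb{N}\to\mathbb{R}$ with $\varepsilon(n)\to 0$ as $n\to\infty$ such that every finite graph $G$ with $\alpha_7(G)\ge 3$ satisfies $\alpha(G)\ge n^{5/12-\varepsilon(n)}$, where $n$ is the number of vertices of $G$. -/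

import Mathlib

open Filter Topology

/-- The `m`-local independence number `α_m(G)`: the minimum of the independence numbers of the
induced subgraphs of `G` on exactly `m` vertices. As a minimum in `ℕ∞` it is `⊤` when `G` has fewer
than `m` vertices, so that `r ≤ α_m(G)` says that any `m` vertices of `G` contain an independent
set of size `r`. -/
noncomputable def SimpleGraph.localIndepNum {V : Type*} (G : SimpleGraph V) (m : ℕ) : ℕ∞ :=
  ⨅ s : {s : Finset V // s.card = m}, ((G.induce (s.1 : Set V)).indepNum : ℕ∞)

/-!
Write `n` for the number of vertices of `G` and `k` for its independence number. The claim follows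
from `n ≤ C * (log n + 1) * k ^ (12 / 5)`, which is `card_le_indepNum_rpow`.

If `G` contains a clique on four vertices, the rest of `G` is triangle-free, because a four-clique and
a disjoint triangle have no independent set of size three; then `n ≤ k ^ 2 + k + 4`. Otherwise `G` has
no four-clique, and it has no Moser spindle either, because this graph has seven vertices and
independence number two. Only these two exclusions are used from there on.

A spindle consists of two diamonds with a common tip `v` whose other tips are adjacent. Call a pair
`v`, `u` rich if it is joined by so many diamonds that one of them avoids any two given middle
vertices. The vertices rich with `v` then form an independent set, so there are at most `k` of them.
Poor pairs are rare: an edge colouring of the link of `v` by `O(k)` colours shows that only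
`O(k ^ 2)` diamonds at `v` have a poor pair of tips (`card_poor_diamond_le`).

The main point is that the average degree is `O(m ^ 2 * k * log k)` as soon as `m ^ 5 > 10 * k`
(`sum_degree_lt`). If it were larger, some vertex `a` would have many neighbours `x` whose degrees in
the link of `a` are about a common value `T`, with small influence of poor pairs and of small
codegrees. Adjacent vertices of the link have disjoint neighbourhoods in it, so a greedy selection
that uses these neighbourhoods as flags (`exists_isIndepSet_of_flags`) would give an independent set
of more than `k` vertices, unless many `x` have at least `m ^ 2 * T` vertices at distance two in the
link. Most of these vertices are rich with `x`, and no vertex is rich with two adjacent vertices. So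
they serve as flags for a second selection. The neighbours of `x` carry only `O(T * k / m)` of these
flags: such a flag `z` is adjacent to some `b` that, unless it is one of few exceptions, has more than
`m` common neighbours with `x` in the link, and most of them are rich with `z`; a double count over
the at most `2 * T` neighbours of `x` in the link, each rich with at most `k` vertices, bounds the
number of such `z`. The selected set has more than `k` vertices when `m ^ 5 > 10 * k`
(`link_bound`).

With `m` about `(10 * k) ^ (1 / 5)`, the greedy bound for graphs of given average degree gives
`n = O(m ^ 2 * k ^ 2 * log k)`, where `m ^ 2 * k ^ 2` is of order `k ^ (12 / 5)`.
-/

namespace SevenThree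

/-! ### Greedy selections -/

open Classical in
/-- Greedy selection of an independent set by flags. Every vertex `x` of `X` carries a set `F x` of
at least `f` flags, adjacent vertices carry disjoint sets, and the neighbours of a vertex carry
together at most `g` different flags. The vertices carrying a given flag `z` form an independent
set `S z`; counting incidences over all flags gives a `z` for which the neighbourhood `N z` of `S z`
in `X` has at most `(g / f) * |S z|` vertices. Take `S z`, discard `N z`, and repeat. -/
theorem exists_isIndepSet_of_flags {V W : Type*} (G : SimpleGraph V) (F : V → Finset W)
    {f g : ℝ} (hf : 0 < f) (hg : 0 ≤ g) (X : Finset V)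
    (hF : ∀ x ∈ X, f ≤ ((F x).card : ℝ))
    (hdisj : ∀ x ∈ X, ∀ y ∈ X, G.Adj x y → Disjoint (F x) (F y))
    (hcard : ∀ x ∈ X, (((X.filter (fun y => G.Adj x y)).biUnion F).card : ℝ) ≤ g) :
    ∃ I ⊆ X, G.IsIndepSet (I : Set V) ∧ (X.card : ℝ) * f ≤ I.card * (f + g) := by
  induction X using Finset.strongInduction with
  | H X ih =>
  rcases X.eq_empty_or_nonempty with rfl | ⟨x₀, hx₀⟩
  · exact ⟨∅, by simp, by simp, by simp⟩
  let Z : Finset W := X.biUnion F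
  let S : W → Finset V := fun z => X.filter (fun x => z ∈ F x)
  let N : W → Finset V := fun z => X.filter (fun y => ∃ x ∈ X, z ∈ F x ∧ G.Adj y x)
  have hS : ∑ z ∈ Z, ((S z).card : ℝ) = ∑ x ∈ X, ((F x).card : ℝ) := by
    have := Finset.sum_card_bipartiteAbove_eq_sum_card_bipartiteBelow (s := X) (t := Z)
      (fun x z => z ∈ F x)
    have h2 : ∀ x ∈ X, (Finset.bipartiteAbove (fun x z => z ∈ F x) Z x) = F x := by
      intro x hx
      ext z
      simp only [Finset.mem_bipartiteAbove, Z, Finset.mem_biUnion]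
      exact ⟨fun h => h.2, fun h => ⟨⟨x, hx, h⟩, h⟩⟩
    rw [Finset.sum_congr rfl (fun x hx => by rw [h2 x hx])] at this
    exact_mod_cast this.symm
  have hN : ∑ z ∈ Z, ((N z).card : ℝ)
      = ∑ y ∈ X, ((((X.filter (fun x => G.Adj y x)).biUnion F).card : ℕ) : ℝ) := by
    have := Finset.sum_card_bipartiteAbove_eq_sum_card_bipartiteBelow (s := X) (t := Z)
      (fun y z => ∃ x ∈ X, z ∈ F x ∧ G.Adj y x)
    have h2 : ∀ y ∈ X, (Finset.bipartiteAbove (fun y z => ∃ x ∈ X, z ∈ F x ∧ G.Adj y x) Z y)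
        = (X.filter (fun x => G.Adj y x)).biUnion F := by
      intro y hy
      ext z
      simp only [Finset.mem_bipartiteAbove, Z, Finset.mem_biUnion, Finset.mem_filter]
      constructor
      · rintro ⟨-, x, hx, hz, ha⟩
        exact ⟨x, ⟨hx, ha⟩, hz⟩
      · rintro ⟨x, ⟨hx, ha⟩, hz⟩
        exact ⟨⟨x, hx, hz⟩, x, hx, hz, ha⟩
    rw [Finset.sum_congr rfl (fun x hx => by rw [h2 x hx])] at this
    exact_mod_cast this.symm
  have hZ : Z.Nonempty := by
    have : 0 < (F x₀).card := by
      have := hF x₀ hx₀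
      exact_mod_cast hf.trans_le this
    obtain ⟨z, hz⟩ := Finset.card_pos.1 this
    exact ⟨z, Finset.mem_biUnion.2 ⟨x₀, hx₀, hz⟩⟩
  obtain ⟨z, hz, hzle⟩ : ∃ z ∈ Z, f * ((N z).card : ℝ) ≤ g * ((S z).card : ℝ) := by
    apply Finset.exists_le_of_sum_le hZ
    rw [← Finset.mul_sum, ← Finset.mul_sum, hS, hN]
    calc f * ∑ y ∈ X, ((((X.filter (fun x => G.Adj y x)).biUnion F).card : ℕ) : ℝ)
        ≤ f * ∑ y ∈ X, g := by gcongr with y hy; exact hcard y hy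
      _ = g * ∑ y ∈ X, f := by simp; ring
      _ ≤ g * ∑ x ∈ X, ((F x).card : ℝ) := by gcongr with y hy; exact hF y hy
  obtain ⟨x₁, hx₁, hzx₁⟩ := Finset.mem_biUnion.1 hz
  let Y : Finset V := X \ (S z ∪ N z)
  have hYX : Y ⊆ X := Finset.sdiff_subset
  have hYss : Y ⊂ X := by
    refine Finset.ssubset_iff_subset_ne.2 ⟨hYX, fun h => ?_⟩
    have : x₁ ∈ Y := h ▸ hx₁
    simp only [Y, S, N, Finset.mem_sdiff, Finset.mem_union, Finset.mem_filter] at this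
    exact this.2 (Or.inl ⟨hx₁, hzx₁⟩)
  obtain ⟨I, hIY, hI, hIcard⟩ := ih Y hYss (fun x hx => hF x (hYX hx))
    (fun x hx y hy => hdisj x (hYX hx) y (hYX hy))
    (fun x hx => le_trans (by
      exact_mod_cast Finset.card_le_card (Finset.biUnion_subset_biUnion_of_subset_left _
        (Finset.filter_subset_filter _ hYX))) (hcard x (hYX hx)))
  have hdIS : Disjoint I (S z) := by
    rw [Finset.disjoint_left]
    intro x hx hxS
    have := hIY hx
    simp only [Y, Finset.mem_sdiff, Finset.mem_union] at this
    exact this.2 (Or.inl hxS)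
  have hcross : ∀ x ∈ I, ∀ y ∈ S z, ¬ G.Adj x y := by
    intro x hx y hy ha
    have h1 := hIY hx
    simp only [Y, Finset.mem_sdiff, Finset.mem_union] at h1
    refine h1.2 (Or.inr ?_)
    simp only [S, Finset.mem_filter] at hy
    simp only [N, Finset.mem_filter]
    exact ⟨h1.1, y, hy.1, hy.2, ha⟩
  have hSS : ∀ x ∈ S z, ∀ y ∈ S z, ¬ G.Adj x y := by
    intro x hx y hy ha
    simp only [S, Finset.mem_filter] at hx hy
    exact Finset.disjoint_left.1 (hdisj x hx.1 y hy.1 ha) hx.2 hy.2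
  refine ⟨I ∪ S z, Finset.union_subset (hIY.trans hYX) (Finset.filter_subset _ _), ?_, ?_⟩
  · intro x hx y hy _ ha
    simp only [Finset.coe_union, Set.mem_union, Finset.mem_coe] at hx hy
    rcases hx with hx | hx <;> rcases hy with hy | hy
    · exact hI hx hy ha.ne ha
    · exact hcross x hx y hy ha
    · exact hcross y hy x hx ha.symm
    · exact hSS x hx y hy ha
  · rw [Finset.card_union_of_disjoint hdIS]
    have h1 : (X.card : ℝ) ≤ Y.card + (S z).card + (N z).card := by
      have a1 : X.card ≤ Y.card + (S z ∪ N z).card := by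
        have := Finset.le_card_sdiff (S z ∪ N z) X
        simp only [Y]
        omega
      have a2 := Finset.card_union_le (S z) (N z)
      exact_mod_cast (by omega : X.card ≤ Y.card + (S z).card + (N z).card)
    push_cast
    nlinarith

open Classical in
/-- The greedy bound of an induced subgraph of maximum degree `μ`, as the case of the selection
lemma in which every vertex is its own flag. -/
lemma card_le_of_degree_le {V : Type*} {G : SimpleGraph V} {k : ℕ}
    (hk : ∀ s : Finset V, G.IsIndepSet (s : Set V) → s.card ≤ k)
    (S : Finset V) (μ : ℕ) (h : ∀ x ∈ S, (S.filter (fun y => G.Adj x y)).card ≤ μ) :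
    S.card ≤ k * (μ + 1) := by
  obtain ⟨I, -, hI, hc⟩ := exists_isIndepSet_of_flags G (fun x => ({x} : Finset V))
    (f := 1) (g := μ) one_pos (by positivity) S (by simp)
    (by intro x _ y _ ha; simpa using ha.ne)
    (by
      intro x hx
      have : ((S.filter (fun y => G.Adj x y)).biUnion fun x => ({x} : Finset V))
          = S.filter (fun y => G.Adj x y) := by ext; simp
      rw [this]
      exact_mod_cast h x hx)
  have h1 : S.card ≤ I.card * (1 + μ) := by
    have : (S.card : ℝ) ≤ I.card * (1 + μ) := by simpa using hc
    exact_mod_cast this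
  calc S.card ≤ I.card * (1 + μ) := h1
    _ ≤ k * (1 + μ) := Nat.mul_le_mul_right _ (hk I hI)
    _ = k * (μ + 1) := by ring

/-- Greedy colouring: a conflict relation in which every element of `S` conflicts with at most `Δ`
elements of `S` has a proper colouring of `S` by the colours `0, …, Δ`. -/
theorem exists_greedy_colouring {β : Type*} (r : β → β → Prop) [DecidableRel r]
    (hsymm : ∀ x y, r x y → r y x) (hirr : ∀ x, ¬ r x x) (Δ : ℕ) (S : Finset β)
    (hΔ : ∀ e ∈ S, (S.filter (r e)).card ≤ Δ) :
    ∃ χ : β → ℕ, (∀ e, χ e ≤ Δ) ∧ ∀ e ∈ S, ∀ e' ∈ S, r e e' → χ e ≠ χ e' := by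
  classical
  induction S using Finset.induction_on with
  | empty => exact ⟨fun _ => 0, by simp, by simp⟩
  | insert e S he ih =>
  obtain ⟨χ, hχ, hχ'⟩ := ih (fun x hx => le_trans (Finset.card_le_card
    (Finset.filter_subset_filter _ (Finset.subset_insert _ _))) (hΔ x (Finset.mem_insert_of_mem hx)))
  obtain ⟨c, hc, hc'⟩ : ∃ c ∈ Finset.range (Δ + 1), c ∉ (S.filter (r e)).image χ := by
    apply Finset.exists_mem_notMem_of_card_lt_card
    refine lt_of_le_of_lt Finset.card_image_le ?_
    rw [Finset.card_range, Nat.lt_succ_iff]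
    exact le_trans (Finset.card_le_card
      (Finset.filter_subset_filter _ (Finset.subset_insert _ _))) (hΔ e (Finset.mem_insert_self _ _))
  have hfree : ∀ x ∈ S, r e x → χ x ≠ c := by
    intro x hx hr h
    exact hc' (Finset.mem_image.2 ⟨x, Finset.mem_filter.2 ⟨hx, hr⟩, h⟩)
  have hne : ∀ x ∈ S, x ≠ e := fun x hx h => he (h ▸ hx)
  refine ⟨Function.update χ e c, ?_, ?_⟩
  · intro x
    by_cases hx : x = e
    · subst hx; simpa [Nat.lt_succ_iff] using hc
    · simpa [hx] using hχ x
  · intro x hx y hy hr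
    rcases Finset.mem_insert.1 hx with hxe | hxS <;> rcases Finset.mem_insert.1 hy with hye | hyS
    · subst hxe; subst hye
      exact (hirr _ hr).elim
    · subst hxe
      simpa [hne y hyS] using (hfree y hyS hr).symm
    · subst hye
      simpa [hne x hxS] using hfree x hxS (hsymm _ _ hr)
    · simpa [hne x hxS, hne y hyS] using hχ' x hxS y hyS hr

/-! ### Rich and poor pairs -/

section Local
open Classical

variable {V : Type*} [Fintype V] (G : SimpleGraph V)

/-- The set of common neighbours of `a` and `b`. -/
noncomputable def coN (a b : V) : Finset V :=
  Finset.univ.filter fun x => G.Adj a x ∧ G.Adj b x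

/-- The set of common neighbours of `a`, `x` and `b`. -/
noncomputable def coN₃ (a x b : V) : Finset V :=
  Finset.univ.filter fun y => G.Adj a y ∧ G.Adj x y ∧ G.Adj b y

/-- `G` has no clique on four vertices. -/
def NoK4 : Prop :=
  ∀ ⦃a b c d : V⦄, G.Adj a b → G.Adj a c → G.Adj a d → G.Adj b c → G.Adj b d → G.Adj c d → False

/-- `G` has no Moser spindle: there are no two diamonds `v, a, b, u` and `v, c, d, w` with common
tip `v`, disjoint middle edges `ab` and `cd`, and adjacent other tips `u`, `w`. No other
distinctness is required of the seven vertices, since each remaining coincidence produces a clique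
on four vertices or a loop. -/
def NoSpindle : Prop :=
  ∀ ⦃v a b c d u w : V⦄, G.Adj v a → G.Adj v b → G.Adj a b → G.Adj u a → G.Adj u b →
    G.Adj v c → G.Adj v d → G.Adj c d → G.Adj w c → G.Adj w d →
    a ≠ c → a ≠ d → b ≠ c → b ≠ d → ¬ G.Adj u w

/-- The pair `v`, `u` is rich if no two vertices cover all the edges inside its common
neighbourhood, so that a diamond with tips `v` and `u` can be found that avoids any two prescribed
middle vertices. A pair that is not rich is called poor. -/
def Rich (v u : V) : Prop :=
  ∀ c d : V, ∃ a ∈ coN G v u, ∃ b ∈ coN G v u, G.Adj a b ∧ a ≠ c ∧ a ≠ d ∧ b ≠ c ∧ b ≠ d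

variable {G}

@[simp] lemma mem_coN {a b x : V} : x ∈ coN G a b ↔ G.Adj a x ∧ G.Adj b x := by simp [coN]

@[simp] lemma mem_coN₃ {a x b y : V} :
    y ∈ coN₃ G a x b ↔ G.Adj a y ∧ G.Adj x y ∧ G.Adj b y := by simp [coN₃]

lemma coN_comm (a b : V) : coN G a b = coN G b a := by ext; simp [and_comm]

lemma Rich.symm {v u : V} (h : Rich G v u) : Rich G u v := by
  intro c d
  rw [coN_comm]
  exact h c d

lemma not_adj_of_rich (hM : NoSpindle G) {z x y c d : V} (hr : Rich G z x)
    (hc : c ∈ coN G z y) (hd : d ∈ coN G z y) (hcd : G.Adj c d) : ¬ G.Adj x y := by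
  obtain ⟨a, ha, b, hb, hab, h1, h2, h3, h4⟩ := hr c d
  simp only [mem_coN] at ha hb hc hd
  exact hM ha.1 hb.1 hab ha.2 hb.2 hc.1 hd.1 hcd hc.2 hd.2 h1 h2 h3 h4

/-- By this lemma the vertices that are rich with a given `z` form an independent set. -/
lemma not_adj_of_rich_of_rich (hM : NoSpindle G) {z x y : V} (hx : Rich G z x)
    (hy : Rich G z y) : ¬ G.Adj x y := by
  obtain ⟨a, ha, b, hb, hab, -⟩ := hy z z
  exact not_adj_of_rich hM hx ha hb hab

variable {k : ℕ}

lemma card_coN_le (hk : ∀ s : Finset V, G.IsIndepSet (s : Set V) → s.card ≤ k) (h4 : NoK4 G)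
    {a b : V} (hab : G.Adj a b) : (coN G a b).card ≤ k := by
  apply hk
  intro x hx y hy _ hxy
  simp only [Finset.mem_coe, mem_coN] at hx hy
  exact h4 hab hx.1 hy.1 hx.2 hy.2 hxy

lemma card_rich_le (hk : ∀ s : Finset V, G.IsIndepSet (s : Set V) → s.card ≤ k)
    (hM : NoSpindle G) (v : V) : (Finset.univ.filter fun u => Rich G v u).card ≤ k := by
  apply hk
  intro x hx y hy _ hxy
  simp only [Finset.coe_filter, Finset.mem_univ, true_and, Set.mem_ofPred_eq] at hx hy
  exact not_adj_of_rich_of_rich hM hx hy hxy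

/-- A proper edge colouring of the link of `v` by `4 * k + 1` colours. Edges are ordered pairs, and
two edges of the same colour are disjoint or have the same ends. The link has maximum degree at most
`k`, as its neighbourhoods are independent sets of `G`. -/
lemma exists_edge_colouring (hk : ∀ s : Finset V, G.IsIndepSet (s : Set V) → s.card ≤ k)
    (h4 : NoK4 G) (v : V) :
    ∃ χ : V × V → ℕ, (∀ e, χ e ≤ 4 * k) ∧ ∀ a b c d, a ∈ coN G v b → b ∈ coN G v a →
      c ∈ coN G v d → d ∈ coN G v c → χ (a, b) = χ (c, d) →
      (a ≠ c ∧ a ≠ d ∧ b ≠ c ∧ b ≠ d) ∨ (a = c ∧ b = d) ∨ (a = d ∧ b = c) := by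
  -- Two edges conflict if they share an end without being equal as unordered pairs.
  let r : V × V → V × V → Prop := fun e e' =>
    (e.1 = e'.1 ∨ e.1 = e'.2 ∨ e.2 = e'.1 ∨ e.2 = e'.2) ∧
      ¬ ((e.1 = e'.1 ∧ e.2 = e'.2) ∨ (e.1 = e'.2 ∧ e.2 = e'.1))
  let S : Finset (V × V) := Finset.univ.filter fun e => e.1 ∈ coN G v e.2 ∧ e.2 ∈ coN G v e.1
  obtain ⟨χ, h1, h2⟩ := exists_greedy_colouring r (by
      rintro ⟨a, b⟩ ⟨c, d⟩ h
      simp only [r] at h ⊢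
      grind) (by
      rintro ⟨a, b⟩ h
      simp [r] at h) (4 * k) S (by
      rintro ⟨a, b⟩ he
      have hab := (Finset.mem_filter.1 he).2
      simp only [mem_coN] at hab
      have hsub : S.filter (r (a, b)) ⊆
          (((coN G v a).image (fun x => (a, x)) ∪ (coN G v a).image (fun x => (x, a))) ∪
          ((coN G v b).image (fun x => (b, x)) ∪ (coN G v b).image (fun x => (x, b)))) := by
        rintro ⟨c, d⟩ hcd
        simp only [S, r, Finset.mem_filter, Finset.mem_univ, true_and, mem_coN] at hcd
        simp only [Finset.mem_union, Finset.mem_image, mem_coN, Prod.mk.injEq]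
        obtain ⟨⟨⟨q1, q2⟩, q3, q4⟩, q5, -⟩ := hcd
        rcases q5 with rfl | rfl | rfl | rfl
        · exact Or.inl (Or.inl ⟨d, ⟨q3, q4⟩, rfl, rfl⟩)
        · exact Or.inl (Or.inr ⟨c, ⟨q1, q2⟩, rfl, rfl⟩)
        · exact Or.inr (Or.inl ⟨d, ⟨q3, q4⟩, rfl, rfl⟩)
        · exact Or.inr (Or.inr ⟨c, ⟨q1, q2⟩, rfl, rfl⟩)
      have ca := card_coN_le hk h4 hab.1.1
      have cb := card_coN_le hk h4 hab.2.1
      refine (Finset.card_le_card hsub).trans ?_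
      refine (Finset.card_union_le _ _).trans ?_
      have e1 := Finset.card_union_le ((coN G v a).image (fun x => (a, x)))
        ((coN G v a).image (fun x => (x, a)))
      have e2 := Finset.card_union_le ((coN G v b).image (fun x => (b, x)))
        ((coN G v b).image (fun x => (x, b)))
      have i1 := Finset.card_image_le (s := coN G v a) (f := fun x => (a, x))
      have i2 := Finset.card_image_le (s := coN G v a) (f := fun x => (x, a))
      have i3 := Finset.card_image_le (s := coN G v b) (f := fun x => (b, x))
      have i4 := Finset.card_image_le (s := coN G v b) (f := fun x => (x, b))
      omega)
  refine ⟨χ, h1, fun a b c d ha hb hc hd he => ?_⟩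
  by_contra hcon
  refine h2 (a, b) (Finset.mem_filter.2 ⟨Finset.mem_univ _, ha, hb⟩)
    (c, d) (Finset.mem_filter.2 ⟨Finset.mem_univ _, hc, hd⟩) ?_ he
  simp only [r]
  grind

/-- There are `O(k ^ 2)` diamonds with a given tip `v` whose other tip `u` is poor with `v`. In a
proper edge colouring of the link of `v`, the other tips `u` over the edges of one colour form an
independent set, by the absence of spindles and four-cliques; so all `u` together see at most
`(4 * k + 1) * k` colours. If `u` is poor, two vertices cover the edges in the common neighbourhood
of `v` and `u`, and the edges at each of them have different colours. -/
lemma card_poor_diamond_le (hk : ∀ s : Finset V, G.IsIndepSet (s : Set V) → s.card ≤ k)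
    (h4 : NoK4 G) (hM : NoSpindle G) (v : V) :
    (Finset.univ.filter fun q : V × V × V => G.Adj q.1 q.2.1 ∧ q.1 ∈ coN G v q.2.2 ∧
      q.2.1 ∈ coN G v q.2.2 ∧ ¬ Rich G v q.2.2).card ≤ 4 * ((4 * k + 1) * k) := by
  obtain ⟨χ, hχ, hmatch⟩ := exists_edge_colouring hk h4 v
  -- `U i`: the tips `u` over edges of colour `i`; `col u`: the colours of the edges below `u`.
  let U : ℕ → Finset V := fun i => Finset.univ.filter fun u =>
    ∃ a b, G.Adj a b ∧ a ∈ coN G v u ∧ b ∈ coN G v u ∧ χ (a, b) = i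
  let col : V → Finset ℕ := fun u => (Finset.range (4 * k + 1)).filter fun i => u ∈ U i
  have hU : ∀ i, (U i).card ≤ k := by
    intro i
    apply hk
    intro u hu w hw _ huw
    simp only [U, Finset.coe_filter, Finset.mem_univ, true_and, Set.mem_ofPred_eq, mem_coN] at hu hw
    obtain ⟨a, b, hab, ⟨va, ua⟩, ⟨vb, ub⟩, hi⟩ := hu
    obtain ⟨c, d, hcd, ⟨vc, wc⟩, ⟨vd, wd⟩, hj⟩ := hw
    have := hmatch a b c d (by simp [va, hab.symm]) (by simp [vb, hab]) (by simp [vc, hcd.symm])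
      (by simp [vd, hcd]) (hi.trans hj.symm)
    rcases this with ⟨h1, h2, h3, h4'⟩ | ⟨rfl, rfl⟩ | ⟨rfl, rfl⟩
    · exact hM va vb hab ua ub vc vd hcd wc wd h1 h2 h3 h4' huw
    · exact h4 huw ua ub wc wd hab
    · exact h4 huw ua ub wd wc hab
  have hcol : ∀ u a b, G.Adj a b → a ∈ coN G v u → b ∈ coN G v u → χ (a, b) ∈ col u := by
    intro u a b hab ha hb
    simp only [col, U, Finset.mem_filter, Finset.mem_range, Finset.mem_univ, true_and]
    exact ⟨Nat.lt_succ_of_le (hχ _), a, b, hab, ha, hb, rfl⟩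
  let E : V → Finset (V × V) := fun u => Finset.univ.filter fun e =>
    G.Adj e.1 e.2 ∧ e.1 ∈ coN G v u ∧ e.2 ∈ coN G v u ∧ ¬ Rich G v u
  have hstar1 : ∀ u c, ((E u).filter fun e => e.1 = c).card ≤ (col u).card := by
    intro u c
    apply Finset.card_le_card_of_injOn χ
    · rintro ⟨a, b⟩ he
      simp only [E, Finset.coe_filter, Finset.mem_filter, Finset.mem_univ, true_and,
        Set.mem_ofPred_eq] at he
      exact hcol u a b he.1.1 he.1.2.1 he.1.2.2.1
    · rintro ⟨a, b⟩ he ⟨a', b'⟩ he' hab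
      simp only [E, Finset.coe_filter, Finset.mem_filter, Finset.mem_univ, true_and,
        Set.mem_ofPred_eq, mem_coN] at he he'
      obtain ⟨⟨q1, q2, q3, -⟩, rfl⟩ := he
      obtain ⟨⟨p1, p2, p3, -⟩, rfl⟩ := he'
      have := hmatch a' b a' b' (by simp [q2.1, q1.symm]) (by simp [q3.1, q1])
        (by simp [p2.1, p1.symm]) (by simp [p3.1, p1]) hab
      grind
  have hstar2 : ∀ u c, ((E u).filter fun e => e.2 = c).card ≤ (col u).card := by
    intro u c
    apply Finset.card_le_card_of_injOn χ
    · rintro ⟨a, b⟩ he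
      simp only [E, Finset.coe_filter, Finset.mem_filter, Finset.mem_univ, true_and,
        Set.mem_ofPred_eq] at he
      exact hcol u a b he.1.1 he.1.2.1 he.1.2.2.1
    · rintro ⟨a, b⟩ he ⟨a', b'⟩ he' hab
      simp only [E, Finset.coe_filter, Finset.mem_filter, Finset.mem_univ, true_and,
        Set.mem_ofPred_eq, mem_coN] at he he'
      obtain ⟨⟨q1, q2, q3, -⟩, rfl⟩ := he
      obtain ⟨⟨p1, p2, p3, -⟩, rfl⟩ := he'
      have := hmatch a b' a' b' (by simp [q2.1, q1.symm]) (by simp [q3.1, q1])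
        (by simp [p2.1, p1.symm]) (by simp [p3.1, p1]) hab
      grind
  have hE : ∀ u, (E u).card ≤ 4 * (col u).card := by
    intro u
    by_cases hr : Rich G v u
    · have : E u = ∅ := by
        ext e
        simp [E, hr]
      simp [this]
    · have hr' := hr
      unfold Rich at hr'
      push Not at hr'
      obtain ⟨c, d, hcd⟩ := hr'
      have hsub : E u ⊆ (((E u).filter fun e => e.1 = c) ∪ ((E u).filter fun e => e.1 = d)) ∪
          (((E u).filter fun e => e.2 = c) ∪ ((E u).filter fun e => e.2 = d)) := by
        rintro ⟨a, b⟩ he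
        have he' := he
        simp only [E, Finset.mem_filter, Finset.mem_univ, true_and] at he'
        have := hcd a he'.2.1 b he'.2.2.1 he'.1
        simp only [Finset.mem_union, Finset.mem_filter, he, true_and]
        tauto
      have := Finset.card_le_card hsub
      have e0 := Finset.card_union_le
        (((E u).filter fun e => e.1 = c) ∪ ((E u).filter fun e => e.1 = d))
        (((E u).filter fun e => e.2 = c) ∪ ((E u).filter fun e => e.2 = d))
      have e1 := Finset.card_union_le ((E u).filter fun e => e.1 = c)
        ((E u).filter fun e => e.1 = d)
      have e2 := Finset.card_union_le ((E u).filter fun e => e.2 = c)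
        ((E u).filter fun e => e.2 = d)
      have := hstar1 u c
      have := hstar1 u d
      have := hstar2 u c
      have := hstar2 u d
      omega
  have hsum : ∑ u, (col u).card ≤ (4 * k + 1) * k := by
    have := Finset.sum_card_bipartiteAbove_eq_sum_card_bipartiteBelow
      (s := (Finset.univ : Finset V)) (t := Finset.range (4 * k + 1)) (fun u i => u ∈ U i)
    calc ∑ u, (col u).card = _ := this
      _ ≤ ∑ i ∈ Finset.range (4 * k + 1), k := by
        refine Finset.sum_le_sum fun i _ => le_trans (Finset.card_le_card ?_) (hU i)
        intro u hu
        exact (Finset.mem_filter.1 hu).2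
      _ = (4 * k + 1) * k := by simp
  calc _ = ∑ u, (E u).card := by
        rw [Finset.card_eq_sum_card_fiberwise (f := fun q : V × V × V => q.2.2)
          (t := Finset.univ) (by simp)]
        refine Finset.sum_congr rfl fun u _ => ?_
        refine Finset.card_bij' (fun q _ => (q.1, q.2.1)) (fun e _ => (e.1, e.2, u)) ?_ ?_ ?_ ?_
        · rintro ⟨a, b, w⟩ h
          simp only [Finset.mem_filter, Finset.mem_univ, true_and] at h
          obtain ⟨h, rfl⟩ := h
          simpa [E] using h
        · rintro ⟨a, b⟩ h
          simpa [E] using h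
        · rintro ⟨a, b, w⟩ h
          simp only [Finset.mem_filter] at h
          simp [h.2]
        · rintro ⟨a, b⟩ h
          rfl
    _ ≤ ∑ u, 4 * (col u).card := Finset.sum_le_sum fun u _ => hE u
    _ = 4 * ∑ u, (col u).card := by rw [Finset.mul_sum]
    _ ≤ _ := Nat.mul_le_mul_left _ hsum

end Local

/-! ### Counting low sets and poor pairs -/

section Counting
open Classical

variable {V : Type*} [Fintype V] (G : SimpleGraph V)

/-- The vertices `b` in the link of `a` that have a common neighbour with `x` inside this link but
at most `m` of them, or that are poor with `x`; empty unless `x` is itself in the link. -/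
noncomputable def lowSet (m : ℕ) (a x : V) : Finset V :=
  Finset.univ.filter fun b => G.Adj a x ∧ G.Adj a b ∧ (coN₃ G a x b).Nonempty ∧
    ((coN₃ G a x b).card ≤ m ∨ ¬ Rich G x b)

/-- The ordered poor pairs inside the common neighbourhood of the ends of the edge `e` (no pairs if
`e` is not an edge). -/
noncomputable def poorPairs (e : V × V) : Finset (V × V) :=
  Finset.univ.filter fun p => G.Adj e.1 e.2 ∧ p.1 ∈ coN G e.1 e.2 ∧ p.2 ∈ coN G e.1 e.2 ∧
    ¬ Rich G p.1 p.2

/-- The common neighbours of `a` and `b` that are poor with at most `m / 2` of the common neighbours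
of `a` and `b`. -/
noncomputable def cleanSet (m : ℕ) (a b : V) : Finset V :=
  (coN G a b).filter fun z => 2 * ((coN G a b).filter fun v => ¬ Rich G v z).card ≤ m

variable {G} {k : ℕ}

/-- For fixed `v`, there are at most `k` vertices `b` rich with `v`, and for each of them the `a`
in question span a subgraph of maximum degree `m` on the common neighbourhood of `v` and `b`. A `b`
poor with `v` contributes a poor diamond with middle edge through `a`. -/
lemma sum_card_lowSet_le (hk : ∀ s : Finset V, G.IsIndepSet (s : Set V) → s.card ≤ k)
    (h4 : NoK4 G) (hM : NoSpindle G) (m : ℕ) (v : V) :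
    ∑ a, (lowSet G m a v).card ≤ k * (k * (m + 1)) + 4 * ((4 * k + 1) * k) := by
  let A : V → Finset V := fun a => Finset.univ.filter fun b =>
    Rich G v b ∧ a ∈ coN G v b ∧ (coN₃ G a v b).card ≤ m
  let B : V → Finset V := fun a => Finset.univ.filter fun b =>
    ¬ Rich G v b ∧ a ∈ coN G v b ∧ (coN₃ G a v b).Nonempty
  have h1 : ∑ a, (A a).card ≤ k * (k * (m + 1)) := by
    have h := Finset.sum_card_bipartiteAbove_eq_sum_card_bipartiteBelow
      (s := (Finset.univ : Finset V)) (t := Finset.univ.filter fun b => Rich G v b)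
      (fun a b => a ∈ coN G v b ∧ (coN₃ G a v b).card ≤ m)
    have h' : ∀ a, (A a) = Finset.bipartiteAbove
        (fun a b => a ∈ coN G v b ∧ (coN₃ G a v b).card ≤ m)
        (Finset.univ.filter fun b => Rich G v b) a := by
      intro a
      ext b
      simp [A, Finset.bipartiteAbove]
    rw [Finset.sum_congr rfl (fun a _ => by rw [h' a]), h]
    calc _ ≤ ∑ b ∈ Finset.univ.filter (fun b => Rich G v b), k * (m + 1) := by
          refine Finset.sum_le_sum fun b _ => ?_
          apply card_le_of_degree_le hk
          intro a ha
          simp only [Finset.mem_bipartiteBelow, Finset.mem_univ, true_and, mem_coN] at ha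
          refine le_trans (Finset.card_le_card ?_) ha.2
          intro y hy
          simp only [Finset.mem_filter, Finset.mem_bipartiteBelow, Finset.mem_univ, true_and,
            mem_coN] at hy
          simp only [mem_coN₃]
          exact ⟨hy.2, hy.1.1.1, hy.1.1.2⟩
      _ = (Finset.univ.filter (fun b => Rich G v b)).card * (k * (m + 1)) := by simp
      _ ≤ _ := Nat.mul_le_mul_right _ (card_rich_le hk hM v)
  have h2 : ∑ a, (B a).card ≤ 4 * ((4 * k + 1) * k) := by
    refine le_trans ?_ (card_poor_diamond_le hk h4 hM v)
    rw [← Finset.card_sigma]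
    apply Finset.card_le_card_of_surjOn (fun q => ⟨q.1, q.2.2⟩)
    rintro ⟨a, b⟩ hab
    simp only [B, Finset.coe_sigma, Set.mem_sigma_iff, Finset.coe_filter, Finset.mem_univ,
      Set.mem_ofPred_eq, true_and] at hab
    obtain ⟨-, hr, ha, y, hy⟩ := hab
    simp only [mem_coN₃, mem_coN] at hy ha
    refine ⟨(a, y, b), ?_, rfl⟩
    simp [hr, ha, hy]
  calc _ ≤ ∑ a, ((A a).card + (B a).card) := by
        refine Finset.sum_le_sum fun a _ => ?_
        refine le_trans (Finset.card_le_card ?_) (Finset.card_union_le _ _)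
        intro b hb
        simp only [lowSet, A, B, Finset.mem_union, Finset.mem_filter, Finset.mem_univ, true_and,
          mem_coN] at hb ⊢
        by_cases hr : Rich G v b
        · exact Or.inl ⟨hr, ⟨hb.1.symm, hb.2.1.symm⟩, hb.2.2.2.resolve_right (not_not.2 hr)⟩
        · exact Or.inr ⟨hr, ⟨hb.1.symm, hb.2.1.symm⟩, hb.2.2.1⟩
    _ = ∑ a, (A a).card + ∑ a, (B a).card := Finset.sum_add_distrib
    _ ≤ _ := add_le_add h1 h2

/-- A poor pair inside the common neighbourhood of an edge is a poor diamond, which is counted at its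
first tip. -/
lemma sum_card_poorPairs_le (hk : ∀ s : Finset V, G.IsIndepSet (s : Set V) → s.card ≤ k)
    (h4 : NoK4 G) (hM : NoSpindle G) :
    ∑ e, (poorPairs G e).card ≤ Fintype.card V * (4 * ((4 * k + 1) * k)) := by
  calc ∑ e, (poorPairs G e).card
      ≤ ∑ v : V, (Finset.univ.filter fun q : V × V × V => G.Adj q.1 q.2.1 ∧ q.1 ∈ coN G v q.2.2 ∧
          q.2.1 ∈ coN G v q.2.2 ∧ ¬ Rich G v q.2.2).card := by
        rw [← Finset.card_sigma, ← Finset.card_sigma]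
        apply Finset.card_le_card_of_injOn (fun q => ⟨q.2.1, q.1.1, q.1.2, q.2.2⟩)
        · rintro ⟨⟨a, b⟩, v, z⟩ h
          simp only [poorPairs, Finset.coe_sigma, Set.mem_sigma_iff, Finset.coe_filter,
            Finset.mem_univ, Set.mem_ofPred_eq, true_and, mem_coN, Finset.coe_univ,
            Set.mem_univ] at h ⊢
          exact ⟨h.1, ⟨h.2.1.1.symm, h.2.2.1.1.symm⟩, ⟨h.2.1.2.symm, h.2.2.1.2.symm⟩, h.2.2.2⟩
        · rintro ⟨⟨a, b⟩, v, z⟩ - ⟨⟨a', b'⟩, v', z'⟩ - h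
          simp only [Sigma.mk.injEq, heq_eq_eq, Prod.mk.injEq] at h ⊢
          tauto
    _ ≤ ∑ v : V, 4 * ((4 * k + 1) * k) :=
        Finset.sum_le_sum fun v _ => card_poor_diamond_le hk h4 hM v
    _ = _ := by simp

lemma card_coN_le_card_cleanSet {m : ℕ} (hm : 1 ≤ m) {a b : V} (hab : G.Adj a b)
    (h : 8 * (poorPairs G (a, b)).card ≤ (coN G a b).card * m) :
    3 * (coN G a b).card ≤ 4 * (cleanSet G m a b).card := by
  let C := coN G a b
  let P : V → Finset V := fun z => C.filter fun v => ¬ Rich G v z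
  let B := C.filter fun z => ¬ 2 * (P z).card ≤ m
  have hBC : (cleanSet G m a b).card + B.card = C.card :=
    Finset.card_filter_add_card_filter_not (s := C) (fun z => 2 * (P z).card ≤ m)
  have hP : ∑ z ∈ C, (P z).card ≤ (poorPairs G (a, b)).card := by
    rw [← Finset.card_sigma]
    apply Finset.card_le_card_of_injOn (fun q => (q.2, q.1))
    · rintro ⟨z, v⟩ h
      simp only [C, P, Finset.coe_sigma, Set.mem_sigma_iff, Finset.coe_filter, Finset.mem_coe,
        Set.mem_ofPred_eq] at h
      simp only [poorPairs, Finset.coe_filter, Finset.mem_univ, Set.mem_ofPred_eq, true_and]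
      exact ⟨hab, h.2.1, h.1, h.2.2⟩
    · rintro ⟨z, v⟩ - ⟨z', v'⟩ - h
      simp only [Prod.mk.injEq, Sigma.mk.injEq, heq_eq_eq] at h ⊢
      tauto
  have hB : B.card * m ≤ 2 * ∑ z ∈ C, (P z).card := by
    calc B.card * m = ∑ z ∈ B, m := by simp
      _ ≤ ∑ z ∈ B, 2 * (P z).card := by
        refine Finset.sum_le_sum fun z hz => ?_
        have := (Finset.mem_filter.1 hz).2
        omega
      _ ≤ ∑ z ∈ C, 2 * (P z).card :=
        Finset.sum_le_sum_of_subset (Finset.filter_subset _ _)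
      _ = _ := by rw [Finset.mul_sum]
  have h5 : 4 * B.card ≤ C.card := by
    have : (4 * B.card) * m ≤ C.card * m := by
      calc (4 * B.card) * m = 4 * (B.card * m) := by ring
        _ ≤ 8 * (poorPairs G (a, b)).card := by omega
        _ ≤ _ := h
    exact Nat.le_of_mul_le_mul_right this hm
  change 3 * C.card ≤ _
  omega

end Counting

/-! ### The structure of one link -/

section Core
open Classical

variable {V : Type*} [Fintype V] {G : SimpleGraph V} {k : ℕ}

/-- No link contains a large set `X` of vertices of degrees between `T` and `2 * T` in the link that
meet few poor pairs and small codegrees: for `m ^ 5 > 10 * k` such an `X` would produce an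
independent set of more than `k` vertices. Degrees in the link of `a` are the numbers
`(coN G a b).card`. The selection lemma is applied twice. The first time the flags of `b` are the
clean common neighbours of `a` and `b`, disjoint for adjacent vertices as there is no four-clique;
its failure means that many `x` see at least `m ^ 2 * T` vertices at distance two in the link. The
second time the flags of `x` are those of these vertices that are rich with `x`, disjoint for adjacent
vertices as there is no spindle. -/
lemma link_bound (hk : ∀ s : Finset V, G.IsIndepSet (s : Set V) → s.card ≤ k)
    (h4 : NoK4 G) (hM : NoSpindle G) {m T : ℕ} (hm : 1 ≤ m) (hkm : 10 * k < m ^ 5)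
    (hT : 8 * m ^ 2 ≤ T) (a : V) (X : Finset V) (hadj : ∀ b ∈ X, G.Adj a b)
    (hpoor : ∀ b ∈ X, 8 * (poorPairs G (a, b)).card ≤ (coN G a b).card * m)
    (hlo : ∀ b ∈ X, T ≤ (coN G a b).card) (hhi : ∀ b ∈ X, (coN G a b).card ≤ 2 * T)
    (hX : 16 * m ^ 2 * k ≤ X.card)
    (hlow : 4 * m * ∑ x ∈ X, (lowSet G m a x).card ≤ 11 * k * X.card)
    (hk0 : 1 ≤ k) : False := by
  have hmR : (1 : ℝ) ≤ m := by exact_mod_cast hm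
  have hkR : (1 : ℝ) ≤ k := by exact_mod_cast hk0
  have hkmR : 10 * (k : ℝ) < (m : ℝ) ^ 5 := by exact_mod_cast hkm
  have hTR : 8 * (m : ℝ) ^ 2 ≤ T := by exact_mod_cast hT
  have hm2 : (1 : ℝ) ≤ (m : ℝ) ^ 2 := one_le_pow₀ hmR
  have hT0 : (0 : ℝ) < T := by linarith
  have hXR : 16 * (m : ℝ) ^ 2 * k ≤ X.card := by exact_mod_cast hX
  have hlowR : 4 * (m : ℝ) * ∑ x ∈ X, ((lowSet G m a x).card : ℝ) ≤ 11 * k * X.card := by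
    exact_mod_cast hlow
  -- By Markov's inequality, at least half of `X` has low sets of at most twice the bound that
  -- `hlow` gives for the average.
  let X₀ : Finset V := X.filter fun x => 2 * m * (lowSet G m a x).card ≤ 11 * k
  have hX₀X : X₀ ⊆ X := Finset.filter_subset _ _
  have hX₀ : 8 * (m : ℝ) ^ 2 * k ≤ X₀.card := by
    let Y : Finset V := X.filter fun x => ¬ 2 * m * (lowSet G m a x).card ≤ 11 * k
    have hXY : X₀.card + Y.card = X.card :=
      Finset.card_filter_add_card_filter_not (s := X) _
    have hY : (Y.card : ℝ) * (11 * k) ≤ ∑ x ∈ X, 2 * (m : ℝ) * (lowSet G m a x).card := by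
      calc (Y.card : ℝ) * (11 * k) = ∑ x ∈ Y, (11 * k : ℝ) := by simp
        _ ≤ ∑ x ∈ Y, 2 * (m : ℝ) * (lowSet G m a x).card := by
          refine Finset.sum_le_sum fun x hx => ?_
          have := (Finset.mem_filter.1 hx).2
          push Not at this
          exact_mod_cast this.le
        _ ≤ _ := Finset.sum_le_sum_of_subset_of_nonneg (Finset.filter_subset _ _)
          (fun _ _ _ => by positivity)
    rw [← Finset.mul_sum] at hY
    have hY' : 2 * (Y.card : ℝ) ≤ X.card := by
      have : (11 * k : ℝ) * (2 * Y.card) ≤ (11 * k) * X.card := by nlinarith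
      exact le_of_mul_le_mul_left this (by positivity)
    have : (X₀.card : ℝ) + Y.card = X.card := by exact_mod_cast hXY
    linarith
  -- First selection. The vertices of `X₀` whose neighbours carry at most `m ^ 2 * T` flags of `F₁`
  -- number at most `k * (1 + 2 * m ^ 2)`, and `X₁` consists of all the others.
  let F₁ : V → Finset V := fun b => cleanSet G m a b
  have hF₁ : ∀ b ∈ X, (T : ℝ) / 2 ≤ (F₁ b).card := by
    intro b hb
    have h1 := card_coN_le_card_cleanSet hm (hadj b hb) (hpoor b hb)
    have h2 := hlo b hb
    have : 3 * T ≤ 4 * (F₁ b).card := le_trans (by omega) h1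
    have : 3 * (T : ℝ) ≤ 4 * (F₁ b).card := by exact_mod_cast this
    linarith
  have hF₁sub : ∀ b, F₁ b ⊆ coN G a b := fun b => Finset.filter_subset _ _
  let R : V → Finset V := fun x => (X₀.filter fun y => G.Adj x y).biUnion F₁
  let X₁ : Finset V := X₀.filter fun x => (m : ℝ) ^ 2 * T < (R x).card
  have hX₁X₀ : X₁ ⊆ X₀ := Finset.filter_subset _ _
  have hX₁ : 4 * (m : ℝ) ^ 2 * k ≤ X₁.card := by
    let Y : Finset V := X₀.filter fun x => ¬ (m : ℝ) ^ 2 * T < (R x).card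
    have hY₀ : Y ⊆ X₀ := Finset.filter_subset _ _
    have hXY : X₁.card + Y.card = X₀.card :=
      Finset.card_filter_add_card_filter_not (s := X₀) _
    obtain ⟨I, -, hI, hc⟩ := exists_isIndepSet_of_flags G F₁ (f := (T : ℝ) / 2)
      (g := (m : ℝ) ^ 2 * T) (by positivity) (by positivity) Y
      (fun x hx => hF₁ x (hX₀X (hY₀ hx)))
      (by
        intro x hx y hy hxy
        rw [Finset.disjoint_left]
        intro z hzx hzy
        have h1 := hF₁sub _ hzx
        have h2 := hF₁sub _ hzy
        rw [mem_coN] at h1 h2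
        exact h4 (hadj x (hX₀X (hY₀ hx))) (hadj y (hX₀X (hY₀ hy))) h1.1 hxy h1.2 h2.2)
      (by
        intro x hx
        have h1 := (Finset.mem_filter.1 hx).2
        push Not at h1
        refine le_trans ?_ h1
        exact_mod_cast Finset.card_le_card (Finset.biUnion_subset_biUnion_of_subset_left _
          (Finset.filter_subset_filter _ hY₀)))
    have hIk : (I.card : ℝ) ≤ k := by exact_mod_cast hk I hI
    have h5 : (Y.card : ℝ) * (T / 2) ≤ k * (T / 2 + m ^ 2 * T) :=
      hc.trans (mul_le_mul_of_nonneg_right hIk (by positivity))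
    have h6 : (Y.card : ℝ) ≤ k * (1 + 2 * m ^ 2) := by
      have : (Y.card : ℝ) * (T / 2) ≤ k * (1 + 2 * m ^ 2) * (T / 2) := by linarith
      exact le_of_mul_le_mul_right this (by positivity)
    have h7 : (X₁.card : ℝ) + Y.card = X₀.card := by exact_mod_cast hXY
    nlinarith
  -- Second selection. A vertex of `R x` has a common neighbour with `x` in the link of `a`, so it lies
  -- in `lowSet G m a x` if it is poor with `x`; hence at least half of `R x` is rich with `x`.
  let F₂ : V → Finset V := fun x => (R x).filter fun z => Rich G x z
  have hF₂ : ∀ x ∈ X₁, (m : ℝ) ^ 2 * T / 2 ≤ (F₂ x).card := by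
    intro x hx
    have hxX := hX₀X (hX₁X₀ hx)
    have hlw : 2 * m * (lowSet G m a x).card ≤ 11 * k := (Finset.mem_filter.1 (hX₁X₀ hx)).2
    have hlwR : 2 * (m : ℝ) * (lowSet G m a x).card ≤ 11 * k := by exact_mod_cast hlw
    have hR := (Finset.mem_filter.1 hx).2
    have hsub : (R x).filter (fun z => ¬ Rich G x z) ⊆ lowSet G m a x := by
      intro z hz
      obtain ⟨hzR, hz⟩ := Finset.mem_filter.1 hz
      obtain ⟨y, hy, hzy⟩ := Finset.mem_biUnion.1 hzR
      obtain ⟨hy, hxy⟩ := Finset.mem_filter.1 hy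
      have h1 := hF₁sub _ hzy
      rw [mem_coN] at h1
      simp only [lowSet, Finset.mem_filter, Finset.mem_univ, true_and]
      refine ⟨hadj x hxX, h1.1, ⟨y, ?_⟩, Or.inr hz⟩
      rw [mem_coN₃]
      exact ⟨hadj y (hX₀X hy), hxy, h1.2.symm⟩
    have hsplit : (F₂ x).card + ((R x).filter (fun z => ¬ Rich G x z)).card = (R x).card :=
      Finset.card_filter_add_card_filter_not (s := R x) _
    have hsplitR : ((R x).card : ℝ) ≤ (F₂ x).card + (lowSet G m a x).card := by
      have := Finset.card_le_card hsub
      exact_mod_cast (by omega : (R x).card ≤ (F₂ x).card + (lowSet G m a x).card)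
    have h5 : ((lowSet G m a x).card : ℝ) ≤ m ^ 2 * T / 2 := by
      have h6 : 2 * (m : ℝ) * (lowSet G m a x).card ≤ 2 * m * (m ^ 2 * T / 2) := by
        calc 2 * (m : ℝ) * (lowSet G m a x).card ≤ 11 * k := hlwR
          _ ≤ 8 * (m : ℝ) ^ 5 := by nlinarith
          _ = 2 * m * (m ^ 2 * (8 * m ^ 2) / 2) := by ring
          _ ≤ _ := by gcongr
      exact le_of_mul_le_mul_left h6 (by positivity)
    linarith
  have hG : ∀ x ∈ X₁,
      ((((X₁.filter fun y => G.Adj x y).biUnion F₂).card : ℕ) : ℝ) ≤ 15 * T * k / m := by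
    intro x hx
    have hxX := hX₀X (hX₁X₀ hx)
    have hlw : 2 * m * (lowSet G m a x).card ≤ 11 * k := (Finset.mem_filter.1 (hX₁X₀ hx)).2
    have hlwR : 2 * (m : ℝ) * (lowSet G m a x).card ≤ 11 * k := by exact_mod_cast hlw
    -- A flag `z` of a neighbour of `x` is a clean common neighbour of `a` and some `b` for which
    -- `a`, `x`, `b` have a common neighbour. Either `b` is low for `x`, and `z` is in `A`, or `a`, `x`,
    -- `b` have more than `m` common neighbours, at most `m / 2` of which are poor with `z` as `z` is
    -- clean, and `z` is in `B`.
    let A : Finset V := (lowSet G m a x ∩ X).biUnion fun b => coN G a b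
    let B : Finset V := Finset.univ.filter fun z =>
      m < 2 * ((coN G a x).filter fun b => Rich G b z).card
    have hA : A.card ≤ (lowSet G m a x).card * (2 * T) := by
      calc A.card ≤ ∑ b ∈ lowSet G m a x ∩ X, (coN G a b).card := Finset.card_biUnion_le
        _ ≤ ∑ b ∈ lowSet G m a x ∩ X, 2 * T :=
          Finset.sum_le_sum fun b hb => hhi b (Finset.mem_inter.1 hb).2
        _ = (lowSet G m a x ∩ X).card * (2 * T) := by simp
        _ ≤ _ := Nat.mul_le_mul_right _ (Finset.card_le_card Finset.inter_subset_left)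
    have hB : B.card * m ≤ 4 * T * k := by
      have h1 := Finset.sum_card_bipartiteAbove_eq_sum_card_bipartiteBelow
        (s := coN G a x) (t := (Finset.univ : Finset V)) (fun b z => Rich G b z)
      calc B.card * m = ∑ z ∈ B, m := by simp
        _ ≤ ∑ z ∈ B, 2 * ((coN G a x).filter fun b => Rich G b z).card :=
          Finset.sum_le_sum fun z hz => (Finset.mem_filter.1 hz).2.le
        _ ≤ ∑ z, 2 * ((coN G a x).filter fun b => Rich G b z).card :=
          Finset.sum_le_sum_of_subset (Finset.subset_univ _)
        _ = 2 * ∑ b ∈ coN G a x, (Finset.univ.filter fun z => Rich G b z).card := by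
          rw [← Finset.mul_sum]
          congr 1
          exact h1.symm
        _ ≤ 2 * ∑ b ∈ coN G a x, k := by
          gcongr with b hb
          exact card_rich_le hk hM b
        _ = 2 * ((coN G a x).card * k) := by simp
        _ ≤ 2 * ((2 * T) * k) := by gcongr; exact hhi x hxX
        _ = 4 * T * k := by ring
    have hsub : (X₁.filter fun y => G.Adj x y).biUnion F₂ ⊆ A ∪ B := by
      intro z hz
      obtain ⟨y, hy, hzy⟩ := Finset.mem_biUnion.1 hz
      obtain ⟨hy, hxy⟩ := Finset.mem_filter.1 hy
      obtain ⟨hzR, -⟩ := Finset.mem_filter.1 hzy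
      obtain ⟨b, hb, hzb⟩ := Finset.mem_biUnion.1 hzR
      obtain ⟨hb, hyb⟩ := Finset.mem_filter.1 hb
      rw [Finset.mem_union]
      by_cases hbl : b ∈ lowSet G m a x
      · exact Or.inl (Finset.mem_biUnion.2
          ⟨b, Finset.mem_inter.2 ⟨hbl, hX₀X hb⟩, hF₁sub _ hzb⟩)
      · right
        obtain ⟨hzab, hzc⟩ := Finset.mem_filter.1 hzb
        have hne : (coN₃ G a x b).Nonempty :=
          ⟨y, by rw [mem_coN₃]; exact ⟨hadj y (hX₀X (hX₁X₀ hy)), hxy, hyb.symm⟩⟩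
        have hbig : m < (coN₃ G a x b).card := by
          by_contra hcon
          exact hbl (by
            simp only [lowSet, Finset.mem_filter, Finset.mem_univ, true_and]
            exact ⟨hadj x hxX, hadj b (hX₀X hb), hne, Or.inl (not_lt.1 hcon)⟩)
        have hsplit := Finset.card_filter_add_card_filter_not (s := coN₃ G a x b)
          (fun v => Rich G v z)
        have hc1 : ((coN₃ G a x b).filter fun v => Rich G v z).card ≤
            ((coN G a x).filter fun v => Rich G v z).card := by
          apply Finset.card_le_card
          apply Finset.filter_subset_filter
          intro v hv
          rw [mem_coN₃] at hv
          rw [mem_coN]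
          exact ⟨hv.1, hv.2.1⟩
        have hc2 : ((coN₃ G a x b).filter fun v => ¬ Rich G v z).card ≤
            ((coN G a b).filter fun v => ¬ Rich G v z).card := by
          apply Finset.card_le_card
          apply Finset.filter_subset_filter
          intro v hv
          rw [mem_coN₃] at hv
          rw [mem_coN]
          exact ⟨hv.1, hv.2.2⟩
        simp only [B, Finset.mem_filter, Finset.mem_univ, true_and]
        omega
    have hcard : (((X₁.filter fun y => G.Adj x y).biUnion F₂).card : ℝ) ≤ A.card + B.card := by
      exact_mod_cast (Finset.card_le_card hsub).trans (Finset.card_union_le _ _)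
    have hAR : (A.card : ℝ) ≤ (lowSet G m a x).card * (2 * T) := by exact_mod_cast hA
    have hBR : (B.card : ℝ) * m ≤ 4 * T * k := by exact_mod_cast hB
    rw [le_div_iff₀ (by positivity)]
    have h8 : (A.card : ℝ) * m ≤ 11 * k * T := by
      calc (A.card : ℝ) * m ≤ (lowSet G m a x).card * (2 * T) * m := by gcongr
        _ = 2 * m * (lowSet G m a x).card * T := by ring
        _ ≤ _ := by gcongr
    nlinarith
  obtain ⟨I, -, hI, hc⟩ := exists_isIndepSet_of_flags G F₂ (f := (m : ℝ) ^ 2 * T / 2)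
    (g := 15 * T * k / m) (by positivity) (by positivity) X₁ hF₂
    (by
      intro x hx y hy hxy
      rw [Finset.disjoint_left]
      intro z hzx hzy
      exact not_adj_of_rich_of_rich hM (Finset.mem_filter.1 hzx).2.symm
        (Finset.mem_filter.1 hzy).2.symm hxy) hG
  have hIk : (I.card : ℝ) ≤ k := by exact_mod_cast hk I hI
  -- Clearing denominators, the selected set has more than `k` vertices unless `4 * m ^ 5` is at most
  -- `m ^ 3 + 30 * k`.
  have h5 : 4 * (m : ℝ) ^ 2 * k * (m ^ 2 * T / 2) ≤ k * (m ^ 2 * T / 2 + 15 * T * k / m) := by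
    calc _ ≤ (X₁.card : ℝ) * (m ^ 2 * T / 2) := by gcongr
      _ ≤ _ := hc
      _ ≤ _ := by gcongr
  have h6 : 4 * (m : ℝ) ^ 5 ≤ m ^ 3 + 30 * k := by
    have hpos : (0 : ℝ) < k * T / (2 * m) := by positivity
    refine le_of_mul_le_mul_right ?_ hpos
    have e1 : 4 * (m : ℝ) ^ 5 * ((k : ℝ) * T / (2 * m)) =
        4 * (m : ℝ) ^ 2 * k * (m ^ 2 * T / 2) := by
      field_simp
    have e2 : ((m : ℝ) ^ 3 + 30 * k) * ((k : ℝ) * T / (2 * m)) =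
        k * (m ^ 2 * T / 2 + 15 * T * k / m) := by
      field_simp
      ring
    rw [e1, e2]
    exact h5
  have h7 : (m : ℝ) ^ 3 ≤ m ^ 5 := pow_le_pow_right₀ hmR (by norm_num)
  linarith

end Core

/-! ### The average degree and the number of vertices -/

section Global
open Classical

variable {V : Type*} [Fintype V] {G : SimpleGraph V} {k : ℕ}

/-- The ordered edges `a`, `b` of codegree at least `16 * m ^ 2` whose common neighbourhood contains
few poor pairs relative to its size. -/
def Usable (G : SimpleGraph V) (m : ℕ) (a b : V) : Prop :=
  G.Adj a b ∧ 16 * m ^ 2 ≤ (coN G a b).card ∧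
    8 * (poorPairs G (a, b)).card ≤ (coN G a b).card * m

/-- All but `O(m ^ 2 * k)` edges per vertex are usable: in each link, the vertices of small degree
are few by the greedy bound, and the edges of large codegree with many poor pairs are few by
`sum_card_poorPairs_le`. -/
lemma sum_degree_le_add (hk : ∀ s : Finset V, G.IsIndepSet (s : Set V) → s.card ≤ k)
    (h4 : NoK4 G) (hM : NoSpindle G) (hk0 : 1 ≤ k) {m : ℕ} (hm : 1 ≤ m)
    (hkm : 10 * k < m ^ 5) :
    ∑ a, (Finset.univ.filter fun b => G.Adj a b).card ≤
      ∑ a, (Finset.univ.filter fun b => Usable G m a b).card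
        + 17 * m ^ 2 * k * Fintype.card V := by
  let A : V → Finset V := fun a => Finset.univ.filter fun b =>
    G.Adj a b ∧ (coN G a b).card < 16 * m ^ 2
  let B : V → Finset V := fun a => Finset.univ.filter fun b =>
    G.Adj a b ∧ 16 * m ^ 2 ≤ (coN G a b).card ∧
      (coN G a b).card * m < 8 * (poorPairs G (a, b)).card
  have hA : ∑ a, (A a).card ≤ Fintype.card V * (k * (16 * m ^ 2)) := by
    calc ∑ a, (A a).card ≤ ∑ a : V, k * (16 * m ^ 2) := by
          refine Finset.sum_le_sum fun a _ => ?_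
          have hpos : 1 ≤ 16 * m ^ 2 := by
            have := Nat.one_le_pow 2 m hm
            omega
          have := card_le_of_degree_le hk (A a) (16 * m ^ 2 - 1) (by
            intro b hb
            have hb := (Finset.mem_filter.1 hb).2
            refine (Finset.card_le_card (t := coN G a b) ?_).trans (Nat.le_sub_one_of_lt hb.2)
            intro c hc
            obtain ⟨hc, hbc⟩ := Finset.mem_filter.1 hc
            rw [mem_coN]
            exact ⟨(Finset.mem_filter.1 hc).2.1, hbc⟩)
          rwa [Nat.sub_add_cancel hpos] at this
      _ = _ := by simp
  have hB : ∑ a, (B a).card ≤ m ^ 2 * k * Fintype.card V := by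
    have h1 : (∑ a, (B a).card) * (16 * m ^ 3) ≤
        8 * (Fintype.card V * (4 * ((4 * k + 1) * k))) := by
      calc (∑ a, (B a).card) * (16 * m ^ 3)
          = ∑ a, ∑ b ∈ B a, 16 * m ^ 3 := by simp [Finset.sum_mul]
        _ ≤ ∑ a, ∑ b ∈ B a, 8 * (poorPairs G (a, b)).card := by
          refine Finset.sum_le_sum fun a _ => Finset.sum_le_sum fun b hb => ?_
          obtain ⟨-, -, h1, h2⟩ := Finset.mem_filter.1 hb
          calc 16 * m ^ 3 = 16 * m ^ 2 * m := by ring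
            _ ≤ (coN G a b).card * m := Nat.mul_le_mul_right _ h1
            _ ≤ _ := h2.le
        _ ≤ ∑ a, ∑ b, 8 * (poorPairs G (a, b)).card :=
          Finset.sum_le_sum fun a _ => Finset.sum_le_sum_of_subset (Finset.subset_univ _)
        _ = 8 * ∑ e, (poorPairs G e).card := by
          rw [Finset.mul_sum, Fintype.sum_prod_type]
        _ ≤ _ := Nat.mul_le_mul_left _ (sum_card_poorPairs_le hk h4 hM)
    have h2 : 8 * (Fintype.card V * (4 * ((4 * k + 1) * k))) ≤
        (m ^ 2 * k * Fintype.card V) * (16 * m ^ 3) := by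
      calc 8 * (Fintype.card V * (4 * ((4 * k + 1) * k)))
          ≤ 8 * (Fintype.card V * (4 * ((4 * k + k) * k))) := by gcongr
        _ = (16 * k * Fintype.card V) * (10 * k) := by ring
        _ ≤ (16 * k * Fintype.card V) * m ^ 5 := Nat.mul_le_mul_left _ hkm.le
        _ = _ := by ring
    exact Nat.le_of_mul_le_mul_right (h1.trans h2) (by positivity)
  calc _ ≤ ∑ a, ((Finset.univ.filter fun b => Usable G m a b).card + ((A a).card + (B a).card)) := by
        refine Finset.sum_le_sum fun a _ => ?_
        have hsub : (Finset.univ.filter fun b => G.Adj a b) ⊆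
            (Finset.univ.filter fun b => Usable G m a b) ∪ (A a ∪ B a) := by
          intro b hb
          have hb := (Finset.mem_filter.1 hb).2
          by_cases h1 : 16 * m ^ 2 ≤ (coN G a b).card
          · by_cases h2 : 8 * (poorPairs G (a, b)).card ≤ (coN G a b).card * m
            · exact Finset.mem_union_left _ (Finset.mem_filter.2 ⟨Finset.mem_univ _, hb, h1, h2⟩)
            · exact Finset.mem_union_right _ (Finset.mem_union_right _
                (Finset.mem_filter.2 ⟨Finset.mem_univ _, hb, h1, not_le.1 h2⟩))
          · exact Finset.mem_union_right _ (Finset.mem_union_left _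
              (Finset.mem_filter.2 ⟨Finset.mem_univ _, hb, not_le.1 h1⟩))
        have := Finset.card_le_card hsub
        have h1 := Finset.card_union_le (Finset.univ.filter fun b => Usable G m a b) (A a ∪ B a)
        have h2 := Finset.card_union_le (A a) (B a)
        omega
    _ = ∑ a, (Finset.univ.filter fun b => Usable G m a b).card +
          (∑ a, (A a).card + ∑ a, (B a).card) := by
        rw [Finset.sum_add_distrib, Finset.sum_add_distrib]
    _ ≤ _ := by
        have : 17 * m ^ 2 * k * Fintype.card V =
          Fintype.card V * (k * (16 * m ^ 2)) + m ^ 2 * k * Fintype.card V := by ring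
        omega

/-- The average degree is `O(m ^ 2 * k * log k)`. Otherwise one dyadic class of codegrees contains
many usable edges, which is where the logarithm is lost, and averaging gives a vertex `a` whose
neighbours in this class contradict `link_bound`. -/
lemma sum_degree_lt (hk : ∀ s : Finset V, G.IsIndepSet (s : Set V) → s.card ≤ k)
    (h4 : NoK4 G) (hM : NoSpindle G) (hk0 : 1 ≤ k) [Nonempty V] {m : ℕ} (hm : 1 ≤ m)
    (hkm : 10 * k < m ^ 5) :
    ∑ a, (Finset.univ.filter fun b => G.Adj a b).card <
      64 * (Nat.log 2 k + 1) * m ^ 2 * k * Fintype.card V := by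
  by_contra hcon
  push Not at hcon
  have husable := hcon.trans (sum_degree_le_add hk h4 hM hk0 hm hkm)
  have hU : (Nat.log 2 k + 1) * (32 * m ^ 2 * k * Fintype.card V) ≤
      ∑ a, (Finset.univ.filter fun b => Usable G m a b).card := by
    have h1 : 17 * m ^ 2 * k * Fintype.card V ≤
        (Nat.log 2 k + 1) * (32 * m ^ 2 * k * Fintype.card V) := by
      calc 17 * m ^ 2 * k * Fintype.card V ≤ 1 * (32 * m ^ 2 * k * Fintype.card V) := by
            rw [one_mul]; gcongr; norm_num
        _ ≤ _ := Nat.mul_le_mul_right _ (by omega)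
    have h2 : 64 * (Nat.log 2 k + 1) * m ^ 2 * k * Fintype.card V =
      2 * ((Nat.log 2 k + 1) * (32 * m ^ 2 * k * Fintype.card V)) := by ring
    omega
  let X : ℕ → V → Finset V := fun i a => (Finset.univ.filter fun b => Usable G m a b).filter
    fun b => Nat.log 2 (coN G a b).card = i
  have hfib : ∀ a, (Finset.univ.filter fun b => Usable G m a b).card =
      ∑ i ∈ Finset.range (Nat.log 2 k + 1), (X i a).card := by
    intro a
    refine Finset.card_eq_sum_card_fiberwise (f := fun b => Nat.log 2 (coN G a b).card) ?_
    intro b hb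
    simp only [Finset.coe_filter, Finset.mem_univ, true_and, Set.mem_ofPred_eq] at hb
    simp only [Finset.coe_range, Set.mem_Iio, Nat.lt_succ_iff]
    exact Nat.log_mono_right (card_coN_le hk h4 hb.1)
  obtain ⟨i, -, hi⟩ : ∃ i ∈ Finset.range (Nat.log 2 k + 1),
      32 * m ^ 2 * k * Fintype.card V ≤ ∑ a, (X i a).card := by
    apply Finset.exists_le_of_sum_le (by simp)
    rw [Finset.sum_comm, ← Finset.sum_congr rfl (fun a _ => hfib a)]
    simpa using hU
  let L : V → ℕ := fun a => ∑ x ∈ X i a, (lowSet G m a x).card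
  have hL : ∑ a, L a ≤ 22 * k ^ 2 * m * Fintype.card V := by
    calc ∑ a, L a ≤ ∑ a, ∑ x, (lowSet G m a x).card :=
          Finset.sum_le_sum fun a _ => Finset.sum_le_sum_of_subset (Finset.subset_univ _)
      _ = ∑ x, ∑ a, (lowSet G m a x).card := Finset.sum_comm
      _ ≤ ∑ x : V, 22 * k ^ 2 * m := by
        refine Finset.sum_le_sum fun x _ => (sum_card_lowSet_le hk h4 hM m x).trans ?_
        calc k * (k * (m + 1)) + 4 * ((4 * k + 1) * k)
            ≤ k * (k * (m + m)) + 4 * ((4 * k * m + k * m) * k) := by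
              have h1 : 1 ≤ k * m := Nat.mul_pos hk0 hm
              have h2 : 4 * k ≤ 4 * k * m := Nat.le_mul_of_pos_right _ hm
              exact add_le_add (by gcongr) (by gcongr)
          _ = 22 * k ^ 2 * m := by ring
      _ = _ := by simp; ring
  -- One inequality yields both requirements on `a`: a large class and small low sets on average.
  obtain ⟨a, -, ha⟩ : ∃ a ∈ (Finset.univ : Finset V),
      11 * k * (16 * m ^ 2 * k) + 4 * m * L a ≤ 11 * k * (X i a).card := by
    apply Finset.exists_le_of_sum_le Finset.univ_nonempty
    rw [Finset.sum_add_distrib, Finset.sum_const, Finset.card_univ, smul_eq_mul,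
      ← Finset.mul_sum, ← Finset.mul_sum]
    calc _ ≤ Fintype.card V * (11 * k * (16 * m ^ 2 * k)) +
          4 * m * (22 * k ^ 2 * m * Fintype.card V) := by gcongr
      _ ≤ 11 * k * (32 * m ^ 2 * k * Fintype.card V) := by
        have : 11 * k * (32 * m ^ 2 * k * Fintype.card V) =
          Fintype.card V * (11 * k * (16 * m ^ 2 * k)) +
          4 * m * (22 * k ^ 2 * m * Fintype.card V) + 88 * (m ^ 2 * k ^ 2 * Fintype.card V) := by
          ring
        omega
      _ ≤ _ := Nat.mul_le_mul_left _ hi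
  have hmem : ∀ b ∈ X i a, Usable G m a b ∧ Nat.log 2 (coN G a b).card = i := by
    intro b hb
    simpa [X] using hb
  have hpos : ∀ b ∈ X i a, (coN G a b).card ≠ 0 := by
    intro b hb
    have := (hmem b hb).1.2.1
    have h2 := Nat.one_le_pow 2 m hm
    omega
  have hXpos : 16 * m ^ 2 * k ≤ (X i a).card :=
    Nat.le_of_mul_le_mul_left ((Nat.le_add_right _ _).trans ha) (by positivity)
  have hlo : ∀ b ∈ X i a, 2 ^ i ≤ (coN G a b).card := by
    intro b hb
    rw [← (hmem b hb).2]
    exact Nat.pow_log_le_self 2 (hpos b hb)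
  have hhi : ∀ b ∈ X i a, (coN G a b).card ≤ 2 * 2 ^ i := by
    intro b hb
    have := Nat.lt_pow_succ_log_self (b := 2) (by norm_num) (coN G a b).card
    rw [(hmem b hb).2, pow_succ] at this
    omega
  have hT : 8 * m ^ 2 ≤ 2 ^ i := by
    have : 0 < (X i a).card := lt_of_lt_of_le (by positivity) hXpos
    obtain ⟨b, hb⟩ := Finset.card_pos.1 this
    have h1 := (hmem b hb).1.2.1
    have h2 := hhi b hb
    omega
  exact link_bound hk h4 hM hm hkm hT a (X i a) (fun b hb => (hmem b hb).1.1)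
    (fun b hb => (hmem b hb).1.2.2) hlo hhi hXpos ((Nat.le_add_left _ _).trans ha) hk0

/-- The greedy bound applied to the vertices of at most twice the average degree. -/
lemma card_le_of_noSpindle (hk : ∀ s : Finset V, G.IsIndepSet (s : Set V) → s.card ≤ k)
    (h4 : NoK4 G) (hM : NoSpindle G) (hk0 : 1 ≤ k) {m : ℕ} (hm : 1 ≤ m)
    (hkm : 10 * k < m ^ 5) :
    Fintype.card V ≤ 258 * (Nat.log 2 k + 1) * m ^ 2 * k ^ 2 := by
  rcases isEmpty_or_nonempty V with hV | hV
  · simp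
  let μ := 128 * (Nat.log 2 k + 1) * m ^ 2 * k
  have hsum := sum_degree_lt hk h4 hM hk0 hm hkm
  let Y : Finset V := Finset.univ.filter fun a =>
    (Finset.univ.filter fun b => G.Adj a b).card ≤ μ
  let Z : Finset V := Finset.univ.filter fun a =>
    ¬ (Finset.univ.filter fun b => G.Adj a b).card ≤ μ
  have hYZ : Y.card + Z.card = Fintype.card V :=
    Finset.card_filter_add_card_filter_not (s := Finset.univ) _
  have hμ : 0 < μ := by positivity
  have hZ : 2 * Z.card ≤ Fintype.card V := by
    have h1 : Z.card * μ ≤ ∑ a, (Finset.univ.filter fun b => G.Adj a b).card := by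
      calc Z.card * μ = ∑ a ∈ Z, μ := by simp
        _ ≤ ∑ a ∈ Z, (Finset.univ.filter fun b => G.Adj a b).card :=
          Finset.sum_le_sum fun a ha => (not_le.1 (Finset.mem_filter.1 ha).2).le
        _ ≤ _ := Finset.sum_le_sum_of_subset (Finset.subset_univ _)
    have h2 : 2 * Z.card * μ ≤ Fintype.card V * μ := by
      have : Fintype.card V * μ =
        2 * (64 * (Nat.log 2 k + 1) * m ^ 2 * k * Fintype.card V) := by
        simp only [μ]; ring
      rw [mul_assoc]
      omega
    exact Nat.le_of_mul_le_mul_right h2 hμ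
  have hY : Y.card ≤ k * (μ + 1) := by
    apply card_le_of_degree_le hk
    intro a ha
    refine le_trans (Finset.card_le_card ?_) (Finset.mem_filter.1 ha).2
    exact Finset.filter_subset_filter _ (Finset.subset_univ _)
  calc Fintype.card V ≤ 2 * (k * (μ + 1)) := by omega
    _ ≤ 2 * (k * (μ + (Nat.log 2 k + 1) * m ^ 2 * k)) := by
      gcongr
      exact Nat.one_le_iff_ne_zero.2 (by positivity)
    _ = _ := by simp only [μ]; ring

end Global

/-! ### Local independence and the bound on the independence number -/

/-- The form in which the local hypothesis is used: among any seven vertices, three are pairwise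
nonadjacent. -/
lemma exists_three_of_seven {V : Type*} {G : SimpleGraph V} (hG : 3 ≤ G.localIndepNum 7)
    (p : Fin 7 → V) (hp : Function.Injective p) :
    ∃ i j l : Fin 7, i ≠ j ∧ i ≠ l ∧ j ≠ l ∧
      ¬ G.Adj (p i) (p j) ∧ ¬ G.Adj (p i) (p l) ∧ ¬ G.Adj (p j) (p l) := by
  classical
  let s : Finset V := Finset.univ.image p
  have hs : s.card = 7 := by simp [s, Finset.card_image_of_injective _ hp]
  have h3 : (3 : ℕ∞) ≤ ((G.induce (s : Set V)).indepNum : ℕ∞) :=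
    hG.trans (iInf_le (fun s : {s : Finset V // s.card = 7} =>
      ((G.induce (s.1 : Set V)).indepNum : ℕ∞)) ⟨s, hs⟩)
  have h3' : 3 ≤ (G.induce (s : Set V)).indepNum := by exact_mod_cast h3
  obtain ⟨t, ht⟩ := (G.induce (s : Set V)).exists_isNIndepSet_indepNum
  have htc : 2 < t.card := by rw [ht.card_eq]; omega
  obtain ⟨x, y, z, hx, hy, hz, hxy, hxz, hyz⟩ := Finset.two_lt_card_iff.1 htc
  have hpre : ∀ x : (s : Set V), ∃ i, p i = x.1 := by
    rintro ⟨x, hx⟩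
    simpa [s] using hx
  obtain ⟨i, hi⟩ := hpre x
  obtain ⟨j, hj⟩ := hpre y
  obtain ⟨l, hl⟩ := hpre z
  have hind := ht.isIndepSet
  refine ⟨i, j, l, ?_, ?_, ?_, ?_, ?_, ?_⟩
  · rintro rfl; exact hxy (Subtype.ext (hi.symm.trans hj))
  · rintro rfl; exact hxz (Subtype.ext (hi.symm.trans hl))
  · rintro rfl; exact hyz (Subtype.ext (hj.symm.trans hl))
  · rw [hi, hj]; exact hind hx hy hxy
  · rw [hi, hl]; exact hind hx hz hxz
  · rw [hj, hl]; exact hind hy hz hyz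

/-- No seven vertices of `G` span all the edges of a graph `E` on `Fin 7` that has no independent
set of size three. -/
lemma false_of_seven {V : Type*} {G : SimpleGraph V} (hG : 3 ≤ G.localIndepNum 7)
    (p : Fin 7 → V) (hp : Function.Injective p) (E : List (Fin 7 × Fin 7))
    (hE : ∀ e ∈ E, G.Adj (p e.1) (p e.2))
    (hcov : ∀ i j l : Fin 7, i ≠ j → i ≠ l → j ≠ l →
      ∃ e ∈ E, (e.1 = i ∨ e.1 = j ∨ e.1 = l) ∧ (e.2 = i ∨ e.2 = j ∨ e.2 = l)) : False := by
  obtain ⟨i, j, l, h1, h2, h3, h4, h5, h6⟩ := exists_three_of_seven hG p hp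
  obtain ⟨⟨x, y⟩, he, hx, hy⟩ := hcov i j l h1 h2 h3
  have hxy := hE _ he
  dsimp only at hx hy hxy
  rcases hx with rfl | rfl | rfl <;> rcases hy with rfl | rfl | rfl <;>
    first
      | exact G.irrefl hxy
      | exact h4 hxy
      | exact h5 hxy
      | exact h6 hxy
      | exact h4 hxy.symm
      | exact h5 hxy.symm
      | exact h6 hxy.symm

/-- The Moser spindle has seven vertices and no independent set of size three. -/
lemma noSpindle_of_noK4 {V : Type*} {G : SimpleGraph V} (hG : 3 ≤ G.localIndepNum 7)
    (h4 : NoK4 G) : NoSpindle G := by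
  intro v a b c d u w va vb ab ua ub vc vd cd wc wd ac ad bc bd uw
  have uv : u ≠ v := by rintro rfl; exact h4 wc wd uw.symm cd vc.symm vd.symm
  have wv : w ≠ v := by rintro rfl; exact h4 ua ub uw ab va.symm vb.symm
  have uc : u ≠ c := by rintro rfl; exact h4 va vb vc ab ua.symm ub.symm
  have ud : u ≠ d := by rintro rfl; exact h4 va vb vd ab ua.symm ub.symm
  have wa : w ≠ a := by rintro rfl; exact h4 va vc vd wc wd cd
  have wb : w ≠ b := by rintro rfl; exact h4 vb vc vd wc wd cd
  have := va.ne; have := vb.ne; have := vc.ne; have := vd.ne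
  have := ab.ne; have := cd.ne; have := ua.ne; have := ub.ne; have := wc.ne; have := wd.ne
  have := uw.ne
  refine false_of_seven hG ![v, a, b, c, d, u, w] ?_
    [(0, 1), (0, 2), (1, 2), (5, 1), (5, 2), (0, 3), (0, 4), (3, 4), (6, 3), (6, 4), (5, 6)]
    ?_ (by decide)
  · intro i j hij
    fin_cases i <;> fin_cases j <;> simp at hij ⊢ <;> grind
  · simp [*]

/-- Outside a clique on four vertices there is no triangle, since a clique on four vertices and a
disjoint triangle cover their seven vertices by two cliques. So all neighbourhoods outside the clique
are independent. -/
lemma card_le_of_not_noK4 {V : Type*} [Fintype V] {G : SimpleGraph V}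
    (hG : 3 ≤ G.localIndepNum 7) (h4 : ¬ NoK4 G) {k : ℕ}
    (hk : ∀ s : Finset V, G.IsIndepSet (s : Set V) → s.card ≤ k) :
    Fintype.card V ≤ k * (k + 1) + 4 := by
  -- Decided before `classical`, which would hide the computable instances.
  have hcov : ∀ i j l : Fin 7, i ≠ j → i ≠ l → j ≠ l →
      ∃ e ∈ ([(0, 1), (0, 2), (0, 3), (1, 2), (1, 3), (2, 3), (4, 5), (4, 6), (5, 6)] :
        List (Fin 7 × Fin 7)), (e.1 = i ∨ e.1 = j ∨ e.1 = l) ∧ (e.2 = i ∨ e.2 = j ∨ e.2 = l) := by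
    decide
  classical
  unfold NoK4 at h4
  push Not at h4
  obtain ⟨a, b, c, d, ab, ac, ad, bc, bd, cd, -⟩ := h4
  let K : Finset V := {a, b, c, d}
  have hK : K.card ≤ 4 := Finset.card_le_four
  have htri : ∀ x ∈ Kᶜ, ∀ y ∈ Kᶜ, ∀ z ∈ Kᶜ, G.Adj x y → G.Adj x z → G.Adj y z → False := by
    intro x hx y hy z hz xy xz yz
    simp only [K, Finset.mem_compl, Finset.mem_insert, Finset.mem_singleton, not_or] at hx hy hz
    have := ab.ne; have := ac.ne; have := ad.ne; have := bc.ne; have := bd.ne; have := cd.ne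
    have := xy.ne; have := xz.ne; have := yz.ne
    refine false_of_seven hG ![a, b, c, d, x, y, z] ?_
      [(0, 1), (0, 2), (0, 3), (1, 2), (1, 3), (2, 3), (4, 5), (4, 6), (5, 6)] ?_ hcov
    · intro i j hij
      fin_cases i <;> fin_cases j <;> simp at hij ⊢ <;> grind
    · simp [*]
  have hY : (Kᶜ).card ≤ k * (k + 1) := by
    apply card_le_of_degree_le hk
    intro x hx
    apply hk
    intro y hy z hz _ hyz
    simp only [Finset.coe_filter, Set.mem_ofPred_eq] at hy hz
    exact htri x hx y hy.1 z hz.1 hy.2 hz.2 hyz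
  have := Finset.card_add_card_compl K
  omega

/-- The quantitative form of the theorem, by `card_le_of_noSpindle` with the least possible `m`, which
is about `(10 * k) ^ (1 / 5)`. -/
lemma card_le_indepNum_rpow {V : Type*} [Fintype V] [Nonempty V] {G : SimpleGraph V}
    (hG : 3 ≤ G.localIndepNum 7) :
    (Fintype.card V : ℝ) ≤
      10320 * (2 * Real.log (Fintype.card V) + 1) * (G.indepNum : ℝ) ^ (12 / 5 : ℝ) := by
  set k := G.indepNum with hkdef
  have hk : ∀ s : Finset V, G.IsIndepSet (s : Set V) → s.card ≤ k :=
    fun s hs => hs.card_le_indepNum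
  have hk0 : 1 ≤ k := by
    obtain ⟨x⟩ := ‹Nonempty V›
    have := hk {x} (by simp)
    simpa using this
  have hkn : k ≤ Fintype.card V := by
    obtain ⟨t, ht⟩ := G.exists_isNIndepSet_indepNum
    rw [hkdef, ← ht.card_eq]
    exact Finset.card_le_univ t
  have hkR : (1 : ℝ) ≤ k := by exact_mod_cast hk0
  have hnR : (1 : ℝ) ≤ Fintype.card V := by exact_mod_cast hk0.trans hkn
  have hlogn : 0 ≤ Real.log (Fintype.card V) := Real.log_nonneg hnR
  have hlog : ((Nat.log 2 k : ℕ) : ℝ) ≤ 2 * Real.log (Fintype.card V) := by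
    have h1 : ((Nat.log 2 k : ℕ) : ℝ) ≤ Real.logb 2 k := by
      exact_mod_cast Real.natLog_le_logb k 2
    have h2 : Real.logb 2 k = Real.log k / Real.log 2 := rfl
    have h3 := Real.log_two_gt_d9
    have h4 : Real.log k ≤ Real.log (Fintype.card V) :=
      Real.log_le_log (by linarith) (by exact_mod_cast hkn)
    rw [h2] at h1
    refine h1.trans ?_
    rw [div_le_iff₀ (by linarith)]
    nlinarith
  have hpow2 : (k : ℝ) ^ 2 ≤ (k : ℝ) ^ (12 / 5 : ℝ) := by
    rw [← Real.rpow_natCast]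
    exact Real.rpow_le_rpow_of_exponent_le hkR (by norm_num)
  by_cases h4 : NoK4 G
  · have hM := noSpindle_of_noK4 hG h4
    let y : ℝ := (10 * k : ℝ) ^ (1 / 5 : ℝ)
    have hy1 : 1 ≤ y := Real.one_le_rpow (by linarith) (by norm_num)
    have hy5 : y ^ 5 = 10 * k := by
      rw [← Real.rpow_natCast, ← Real.rpow_mul (by positivity)]
      norm_num
    let m : ℕ := ⌊y⌋₊ + 1
    have hym : y < m := by
      have := Nat.lt_floor_add_one y
      simpa [m] using this
    have hm2 : (m : ℝ) ≤ 2 * y := by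
      have := Nat.floor_le (zero_le_one.trans hy1)
      simp only [m]
      push_cast
      linarith
    have hkm : 10 * k < m ^ 5 := by
      have : (10 * k : ℝ) < (m : ℝ) ^ 5 := by
        rw [← hy5]
        exact pow_lt_pow_left₀ hym (zero_le_one.trans hy1) (by norm_num)
      exact_mod_cast this
    have hbound := card_le_of_noSpindle hk h4 hM hk0 (m := m) (by simp [m]) hkm
    have hboundR : (Fintype.card V : ℝ) ≤
        258 * ((Nat.log 2 k : ℕ) + 1) * (m : ℝ) ^ 2 * (k : ℝ) ^ 2 := by exact_mod_cast hbound
    have hy2 : y ^ 2 ≤ 10 * (k : ℝ) ^ (2 / 5 : ℝ) := by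
      have e1 : y ^ 2 = (10 : ℝ) ^ (2 / 5 : ℝ) * (k : ℝ) ^ (2 / 5 : ℝ) := by
        rw [← Real.mul_rpow (by norm_num) (by positivity), ← Real.rpow_natCast,
          ← Real.rpow_mul (by positivity)]
        norm_num
      rw [e1]
      gcongr
      calc (10 : ℝ) ^ (2 / 5 : ℝ) ≤ (10 : ℝ) ^ (1 : ℝ) :=
            Real.rpow_le_rpow_of_exponent_le (by norm_num) (by norm_num)
        _ = 10 := by norm_num
    have hm3 : (m : ℝ) ^ 2 ≤ 40 * (k : ℝ) ^ (2 / 5 : ℝ) := by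
      calc (m : ℝ) ^ 2 ≤ (2 * y) ^ 2 := by gcongr
        _ = 4 * y ^ 2 := by ring
        _ ≤ _ := by linarith
    have hsplit : (k : ℝ) ^ (12 / 5 : ℝ) = (k : ℝ) ^ (2 / 5 : ℝ) * (k : ℝ) ^ 2 := by
      rw [← Real.rpow_natCast, ← Real.rpow_add (by linarith)]
      norm_num
    calc (Fintype.card V : ℝ) ≤ 258 * ((Nat.log 2 k : ℕ) + 1) * (m : ℝ) ^ 2 * (k : ℝ) ^ 2 := hboundR
      _ ≤ 258 * (2 * Real.log (Fintype.card V) + 1) * (40 * (k : ℝ) ^ (2 / 5 : ℝ)) * (k : ℝ) ^ 2 := by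
        gcongr
      _ = _ := by rw [hsplit]; ring
  · have h := card_le_of_not_noK4 hG h4 hk
    have hR : (Fintype.card V : ℝ) ≤ k * (k + 1) + 4 := by exact_mod_cast h
    have h6 : (Fintype.card V : ℝ) ≤ 6 * (k : ℝ) ^ 2 := by nlinarith
    calc (Fintype.card V : ℝ) ≤ 6 * (k : ℝ) ^ 2 := h6
      _ ≤ 10320 * (2 * 0 + 1) * (k : ℝ) ^ 2 := by nlinarith [sq_nonneg (k : ℝ)]
      _ ≤ _ := by gcongr

lemma tendsto_log_div_log (C : ℝ) (hC : 0 < C) :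
    Tendsto (fun n : ℕ => Real.log (C * (2 * Real.log n + 1)) / Real.log n) atTop (𝓝 0) := by
  have hlog : Tendsto (fun n : ℕ => Real.log (n : ℝ)) atTop atTop :=
    Real.tendsto_log_atTop.comp tendsto_natCast_atTop_atTop
  have hreal : Tendsto (fun x : ℝ => Real.log (C * (2 * x + 1)) / x) atTop (𝓝 0) := by
    have hy : Tendsto (fun x : ℝ => C * (2 * x + 1)) atTop atTop :=
      (tendsto_atTop_add_const_right _ _ (tendsto_id.const_mul_atTop two_pos)).const_mul_atTop hC
    have h1 : Tendsto (fun x : ℝ => Real.log (C * (2 * x + 1)) / (C * (2 * x + 1))) atTop (𝓝 0) :=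
      Real.isLittleO_log_id_atTop.tendsto_div_nhds_zero.comp hy
    have h2 : Tendsto (fun x : ℝ => C * (2 + x⁻¹)) atTop (𝓝 (C * (2 + 0))) :=
      (tendsto_const_nhds.add tendsto_inv_atTop_zero).const_mul C
    have h3 := h1.mul h2
    rw [zero_mul] at h3
    refine h3.congr' ?_
    filter_upwards [eventually_gt_atTop 0] with x hx
    field_simp
  exact hreal.comp hlog

end SevenThree

theorem mainTheorem1 :
    ∃ ε : ℕ → ℝ, Tendsto ε atTop (𝓝 0) ∧
      ∀ (V : Type*) [Fintype V] (G : SimpleGraph V),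
        3 ≤ G.localIndepNum 7 →
          (Fintype.card V : ℝ) ^ ((5 : ℝ) / 12 - ε (Fintype.card V)) ≤ (G.indepNum : ℝ) := by
  -- The error term is chosen so that `n` to it is `q ^ (5 / 12)`, for `q` the logarithmic factor in
  -- `card_le_indepNum_rpow`.
  refine ⟨fun n => 5 / 12 * (Real.log (10320 * (2 * Real.log n + 1)) / Real.log n), ?_, ?_⟩
  · simpa using (SevenThree.tendsto_log_div_log 10320 (by norm_num)).const_mul (5 / 12 : ℝ)
  · intro V _ G hG
    rcases isEmpty_or_nonempty V with hV | hV
    · simp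
    have hbound := SevenThree.card_le_indepNum_rpow hG
    set n := Fintype.card V with hn
    have hn1 : 1 ≤ n := Fintype.card_pos
    have hk0 : (1 : ℝ) ≤ G.indepNum := by
      obtain ⟨x⟩ := hV
      have : ({x} : Finset V).card ≤ G.indepNum :=
        SimpleGraph.IsIndepSet.card_le_indepNum (by simp)
      exact_mod_cast this
    rcases hn1.eq_or_lt with h1 | h1
    · rw [← h1]
      simpa using hk0
    have hnR : (1 : ℝ) < n := by exact_mod_cast h1
    have hlogpos : 0 < Real.log n := Real.log_pos hnR
    set q : ℝ := 10320 * (2 * Real.log n + 1) with hq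
    have hq0 : 0 < q := by positivity
    have hpow : (n : ℝ) ^ (5 / 12 * (Real.log q / Real.log n)) = q ^ (5 / 12 : ℝ) := by
      rw [Real.rpow_def_of_pos (by linarith), Real.rpow_def_of_pos hq0]
      congr 1
      field_simp
    rw [Real.rpow_sub (by linarith), hpow, div_le_iff₀ (by positivity)]
    calc (n : ℝ) ^ ((5 : ℝ) / 12) ≤ (q * (G.indepNum : ℝ) ^ (12 / 5 : ℝ)) ^ ((5 : ℝ) / 12) := by
          gcongr
      _ = q ^ ((5 : ℝ) / 12) * G.indepNum := by
        rw [Real.mul_rpow hq0.le (by positivity), ← Real.rpow_mul (by linarith)]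
        norm_num
      _ = _ := mul_comm _ _
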